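/- All topological groups are Hausdorff. For topological abelian groups $G,H$, an \emph{extension} of $G$ by $H$ is a short exact sequence $0\to H\xrightarrow{\imath}X\xrightarrow{\pi}G\to 0$ of topological abelian groups in which the homomorphisms $\imath$ and $\pi$ are continuous and open onto their images. Two extensions $0\to H\xrightarrow{\imath}X\xrightarrow{\pi}G\to 0$ and $0\to H\xrightarrow{\imath'}X'\xrightarrow{\pi'}G\to 0$ are \emph{equivalent} if there is a continuous homomorphism $T:X\to X'$ with $T\circ\imath=\imath'$ and $\pi'\circ T=\pi$. Let $\mathrm{Ext}(G,H)$ be the abelian group of equivalence classes of extensions of $G$ by $H$ under the Baer sum, where $E_1+E_2$ is obtained from the product extension $0\to H\times H\to X_1\times X_2\to G\times G\to 0$ by pulling back along the diagonal $G\to G\times G$ and then pushing out along the addition $H\times H\to H$. A topological space is \emph{\v{C}ech-complete} if it is Tychonoff and is a $G_\delta$ subset of its Stone--\v{C}ech compactification. Theorem. Let $G$ be a topological abelian group, let $D$ be a dense subgroup of $G$ with the subspace topology, and let $H$ be a \v{C}ech-complete topological abelian group. Then there is an isomorphism of abelian groups $\mathrm{Ext}(G,H)\cong\mathrm{Ext}(D,H)$.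 -/

import Mathlib

open Topology

universe u v

/-- A topological space is Čech-complete if it is a Tychonoff space that is a `G_δ` subset of its
Stone-Čech compactification. -/
class CechCompleteSpace (X : Type u) [TopologicalSpace X] : Prop where
  t35Space : T35Space X
  isGδ_range : IsGδ (Set.range (stoneCechUnit : X → StoneCech X))

/-- An extension of topological abelian groups `0 → H → X → G → 0`: a short exact sequence whose
maps are continuous homomorphisms that are open onto their images. For the injective map `ι` this
says that `ι` is a topological embedding, for the surjective map `π` that it is an open quotient
map. As shown in `TopAddExtension.t2Space`, the group `X` is Hausdorff if `G` and `H` are. Since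
`X` has the cardinality of `H × G`, the universe of `X` is no restriction. -/
structure TopAddExtension (G : Type u) (H : Type v) [AddCommGroup G] [TopologicalSpace G]
    [AddCommGroup H] [TopologicalSpace H] where
  /-- the middle group -/
  X : Type (max u v)
  [addCommGroup : AddCommGroup X]
  [topologicalSpace : TopologicalSpace X]
  [isTopologicalAddGroup : IsTopologicalAddGroup X]
  /-- the inclusion -/
  ι : H →ₜ+ X
  /-- the projection -/
  π : X →ₜ+ G
  isEmbedding : IsEmbedding ι
  isOpenQuotientMap : IsOpenQuotientMap π
  exact : Function.Exact ι π

namespace TopAddExtension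

attribute [instance] addCommGroup topologicalSpace isTopologicalAddGroup

section Basic

variable {G : Type u} {H : Type v} [AddCommGroup G] [TopologicalSpace G]
  [AddCommGroup H] [TopologicalSpace H]

theorem π_ι (E : TopAddExtension G H) (h : H) : E.π (E.ι h) = 0 :=
  (E.exact _).2 ⟨h, rfl⟩

theorem t2Space (E : TopAddExtension G H) [T2Space G] [T2Space H] : T2Space E.X := by
  have hc : IsClosed (E.π ⁻¹' {0}) := isClosed_singleton.preimage E.isOpenQuotientMap.continuous
  have hr : Set.range E.ι = E.π ⁻¹' {0} := by
    ext x
    exact (E.exact x).symm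
  have hι : IsClosedEmbedding E.ι := ⟨E.isEmbedding, hr ▸ hc⟩
  have h0 : IsClosed ({0} : Set E.X) := by
    have := hι.isClosedMap {0} isClosed_singleton
    simpa using this
  have : T1Space E.X := IsTopologicalAddGroup.t1Space _ h0
  infer_instance

/-- Two extensions of `G` by `H` are equivalent if there is a continuous homomorphism between the
middle groups that is compatible with the inclusions of `H` and the projections to `G`. -/
def Equivalent (E E' : TopAddExtension G H) : Prop :=
  ∃ T : E.X →ₜ+ E'.X, (∀ h, T (E.ι h) = E'.ι h) ∧ ∀ x, E'.π (T x) = E.π x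

theorem Equivalent.refl (E : TopAddExtension G H) : Equivalent E E :=
  ⟨ContinuousAddMonoidHom.id _, fun _ => rfl, fun _ => rfl⟩

theorem Equivalent.trans {E E' E'' : TopAddExtension G H} (h : Equivalent E E')
    (h' : Equivalent E' E'') : Equivalent E E'' := by
  obtain ⟨T, h1, h2⟩ := h
  obtain ⟨T', h1', h2'⟩ := h'
  exact ⟨T'.comp T, fun x => by simp [h1, h1'], fun x => by simp [h2, h2']⟩

theorem Equivalent.symm {E E' : TopAddExtension G H} (h : Equivalent E E') :
    Equivalent E' E := by
  obtain ⟨T, h1, h2⟩ := h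
  have hinj : Function.Injective T := by
    rw [injective_iff_map_eq_zero]
    intro x hx
    obtain ⟨k, rfl⟩ := (E.exact x).1 (by rw [← h2, hx, map_zero])
    rw [h1, map_eq_zero_iff _ E'.isEmbedding.injective] at hx
    rw [hx, map_zero]
  have hsurj : Function.Surjective T := by
    intro x'
    obtain ⟨x, hx⟩ := E.isOpenQuotientMap.surjective (E'.π x')
    obtain ⟨k, hk⟩ := (E'.exact (x' - T x)).1 (by rw [map_sub, h2, hx, sub_self])
    exact ⟨x + E.ι k, by rw [map_add, h1, hk]; abel⟩
  let e : E.X ≃+ E'.X := AddEquiv.ofBijective T.toAddMonoidHom ⟨hinj, hsurj⟩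
  have he : ∀ x, e x = T x := fun _ => rfl
  have hcont : Continuous e.symm := by
    refine continuous_of_continuousAt_zero e.symm ?_
    rw [ContinuousAt, map_zero]
    intro U hU
    obtain ⟨V, hV, hVU⟩ := exists_nhds_zero_half hU
    have hVι : E.ι ⁻¹' V ∈ 𝓝 (0 : H) :=
      E.ι.continuous_toFun.continuousAt.preimage_mem_nhds (by simpa using hV)
    rw [E'.isEmbedding.nhds_eq_comap, map_zero] at hVι
    obtain ⟨W, hW, hWV⟩ := Filter.mem_comap.1 hVι
    obtain ⟨W', hW', hWW⟩ := exists_nhds_half_neg hW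
    have hTW : T ⁻¹' W' ∈ 𝓝 (0 : E.X) :=
      T.continuous_toFun.continuousAt.preimage_mem_nhds (by simpa using hW')
    have hπ : E.π '' (V ∩ T ⁻¹' W') ∈ 𝓝 (0 : G) := by
      have := E.isOpenQuotientMap.isOpenMap.image_mem_nhds (Filter.inter_mem hV hTW)
      simpa using this
    have hπ' : E'.π ⁻¹' (E.π '' (V ∩ T ⁻¹' W')) ∈ 𝓝 (0 : E'.X) :=
      E'.π.continuous_toFun.continuousAt.preimage_mem_nhds (by simpa using hπ)
    change e.symm ⁻¹' U ∈ 𝓝 0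
    filter_upwards [Filter.inter_mem hW' hπ'] with x' hx'
    obtain ⟨hxW, v, ⟨hvV, hvW⟩, hv⟩ := hx'
    obtain ⟨k, hk⟩ := (E'.exact (x' - T v)).1 (by rw [map_sub, h2, hv, sub_self])
    have hkV : E.ι k ∈ V := hWV (by
      change E'.ι k ∈ W
      rw [hk]
      exact hWW _ hxW _ hvW)
    have : e.symm x' = v + E.ι k := by
      rw [AddEquiv.symm_apply_eq, he, map_add, h1, hk]
      abel
    change e.symm x' ∈ U
    rw [this]
    exact hVU _ hvV _ hkV
  refine ⟨⟨e.symm.toAddMonoidHom, hcont⟩, fun k => ?_, fun x => ?_⟩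
  · change e.symm (E'.ι k) = E.ι k
    rw [AddEquiv.symm_apply_eq, he, h1]
  · change E.π (e.symm x) = E'.π x
    rw [← h2, ← he, e.apply_symm_apply]

instance setoid (G : Type u) (H : Type v) [AddCommGroup G] [TopologicalSpace G]
    [AddCommGroup H] [TopologicalSpace H] : Setoid (TopAddExtension G H) where
  r := Equivalent
  iseqv := ⟨Equivalent.refl, Equivalent.symm, Equivalent.trans⟩

/-- The trivial extension `0 → H → H × G → G → 0`. -/
def trivial (G : Type u) (H : Type v) [AddCommGroup G] [TopologicalSpace G]
    [AddCommGroup H] [TopologicalSpace H] [IsTopologicalAddGroup G] [IsTopologicalAddGroup H] :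
    TopAddExtension G H where
  X := H × G
  ι := ContinuousAddMonoidHom.inl H G
  π := ContinuousAddMonoidHom.snd H G
  isEmbedding := isEmbedding_prodMkLeft 0
  isOpenQuotientMap := ⟨Prod.snd_surjective, continuous_snd, isOpenMap_snd⟩
  exact := by
    rintro ⟨h, g⟩
    constructor
    · rintro rfl
      exact ⟨h, rfl⟩
    · rintro ⟨k, hk⟩
      exact (congrArg Prod.snd hk).symm

/-- The extension obtained from `E` by changing the sign of the inclusion. -/
def neg [IsTopologicalAddGroup H] (E : TopAddExtension G H) : TopAddExtension G H where
  X := E.X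
  ι := E.ι.comp (ContinuousAddMonoidHom.neg H)
  π := E.π
  isEmbedding := E.isEmbedding.comp (Homeomorph.neg H).isEmbedding
  isOpenQuotientMap := E.isOpenQuotientMap
  exact := by
    intro x
    rw [E.exact x]
    constructor
    · rintro ⟨h, rfl⟩
      exact ⟨-h, by simp⟩
    · rintro ⟨h, rfl⟩
      exact ⟨-h, rfl⟩

end Basic

section Prod

variable {G₁ G₂ : Type u} {H₁ H₂ : Type v}
  [AddCommGroup G₁] [TopologicalSpace G₁] [AddCommGroup H₁] [TopologicalSpace H₁]
  [AddCommGroup G₂] [TopologicalSpace G₂] [AddCommGroup H₂] [TopologicalSpace H₂]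

/-- The product extension `0 → H₁ × H₂ → X₁ × X₂ → G₁ × G₂ → 0`. -/
def prod (E₁ : TopAddExtension G₁ H₁) (E₂ : TopAddExtension G₂ H₂) :
    TopAddExtension (G₁ × G₂) (H₁ × H₂) where
  X := E₁.X × E₂.X
  ι := E₁.ι.prodMap E₂.ι
  π := E₁.π.prodMap E₂.π
  isEmbedding := E₁.isEmbedding.prodMap E₂.isEmbedding
  isOpenQuotientMap := E₁.isOpenQuotientMap.prodMap E₂.isOpenQuotientMap
  exact := by
    rintro ⟨x, y⟩
    constructor
    · intro h
      obtain ⟨a, ha⟩ := (E₁.exact x).1 (congrArg Prod.fst h)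
      obtain ⟨b, hb⟩ := (E₂.exact y).1 (congrArg Prod.snd h)
      exact ⟨(a, b), Prod.ext ha hb⟩
    · rintro ⟨⟨a, b⟩, hab⟩
      exact Prod.ext ((E₁.exact x).2 ⟨a, congrArg Prod.fst hab⟩)
        ((E₂.exact y).2 ⟨b, congrArg Prod.snd hab⟩)

end Prod

section Pullback

variable {G G' : Type u} {H : Type v}
  [AddCommGroup G] [TopologicalSpace G] [AddCommGroup H] [TopologicalSpace H]
  [AddCommGroup G'] [TopologicalSpace G']

/-- The pull-back `{(x, y) ∈ X × G' | π x = t y}` of `π : X → G` and `t : G' → G`. -/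
def pullbackGroup (E : TopAddExtension G H) (t : G' →ₜ+ G) : AddSubgroup (E.X × G') where
  carrier := {p | E.π p.1 = t p.2}
  add_mem' := by
    intro a b ha hb
    simp only [Set.mem_ofPred_eq] at *
    simp [ha, hb]
  zero_mem' := by simp
  neg_mem' := by
    intro a ha
    simp only [Set.mem_ofPred_eq] at *
    simp [ha]

theorem ι_mem_pullbackGroup (E : TopAddExtension G H) (t : G' →ₜ+ G) (h : H) :
    (E.ι h, (0 : G')) ∈ E.pullbackGroup t := by
  change E.π (E.ι h) = t 0
  rw [E.π_ι, map_zero]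

/-- The inclusion `h ↦ (ι h, 0)` of `H` into the pull-back. -/
def pullbackι (E : TopAddExtension G H) (t : G' →ₜ+ G) : H →ₜ+ E.pullbackGroup t where
  toFun h := ⟨(E.ι h, 0), E.ι_mem_pullbackGroup t h⟩
  map_zero' := by ext <;> simp
  map_add' a b := by ext <;> simp
  continuous_toFun := (E.ι.continuous_toFun.prodMk continuous_const).subtype_mk _

/-- The projection `(x, y) ↦ y` of the pull-back to `G'`. -/
def pullbackπ (E : TopAddExtension G H) (t : G' →ₜ+ G) : E.pullbackGroup t →ₜ+ G' where
  toFun p := p.1.2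
  map_zero' := rfl
  map_add' _ _ := rfl
  continuous_toFun := continuous_snd.comp continuous_subtype_val

/-- The pull-back extension `E t` of `E` along a continuous homomorphism `t : G' → G`. -/
def pullback [IsTopologicalAddGroup G'] (E : TopAddExtension G H) (t : G' →ₜ+ G) :
    TopAddExtension G' H where
  X := E.pullbackGroup t
  ι := E.pullbackι t
  π := E.pullbackπ t
  isEmbedding := by
    refine IsEmbedding.of_comp (E.pullbackι t).continuous_toFun
      (continuous_fst.comp continuous_subtype_val) ?_
    exact E.isEmbedding
  isOpenQuotientMap := by
    refine ⟨fun y => ?_, continuous_snd.comp continuous_subtype_val, ?_⟩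
    · obtain ⟨x, hx⟩ := E.isOpenQuotientMap.surjective (t y)
      exact ⟨⟨(x, y), hx⟩, rfl⟩
    · rw [isOpenMap_iff_nhds_le]
      rintro ⟨⟨x, y⟩, hxy⟩ S hS
      rw [Filter.mem_map, nhds_subtype_eq_comap, Filter.mem_comap] at hS
      obtain ⟨W, hW, hWS⟩ := hS
      rw [nhds_prod_eq, Filter.mem_prod_iff] at hW
      obtain ⟨A, hA, B, hB, hAB⟩ := hW
      have h1 : E.π '' A ∈ 𝓝 (t y) := by
        have := E.isOpenQuotientMap.isOpenMap.image_mem_nhds hA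
        rwa [show E.π x = t y from hxy] at this
      have h2 : t ⁻¹' (E.π '' A) ∈ 𝓝 y := t.continuous_toFun.continuousAt.preimage_mem_nhds h1
      change S ∈ 𝓝 y
      filter_upwards [Filter.inter_mem h2 hB] with z hz
      obtain ⟨⟨a, ha, haz⟩, hzB⟩ := hz
      exact hWS (show (⟨(a, z), haz⟩ : E.pullbackGroup t) ∈ _ from hAB ⟨ha, hzB⟩)
  exact := by
    rintro ⟨⟨x, y⟩, hxy⟩
    constructor
    · intro h
      change y = 0 at h
      subst h
      obtain ⟨k, hk⟩ := (E.exact x).1 (by rw [show E.π x = t 0 from hxy, map_zero])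
      exact ⟨k, Subtype.ext (Prod.ext hk rfl)⟩
    · rintro ⟨k, hk⟩
      exact (congrArg (E.pullbackπ t) hk).symm

end Pullback

section Pushout

variable {G : Type u} {H H' : Type v}
  [AddCommGroup G] [TopologicalSpace G] [AddCommGroup H] [TopologicalSpace H]
  [AddCommGroup H'] [TopologicalSpace H']

/-- The subgroup `{(t h, -ι h) | h ∈ H}` of `H' × X`. -/
def pushoutSubgroup (E : TopAddExtension G H) (t : H →ₜ+ H') : AddSubgroup (H' × E.X) :=
  (t.toAddMonoidHom.prod (-E.ι.toAddMonoidHom)).range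

theorem mem_pushoutSubgroup (E : TopAddExtension G H) (t : H →ₜ+ H') (p : H' × E.X) :
    p ∈ E.pushoutSubgroup t ↔ ∃ h, t h = p.1 ∧ -E.ι h = p.2 := by
  constructor
  · rintro ⟨h, rfl⟩
    exact ⟨h, rfl, rfl⟩
  · rintro ⟨h, h1, h2⟩
    exact ⟨h, Prod.ext h1 h2⟩

/-- The push-out extension `t E` of `E` along a continuous homomorphism `t : H → H'`; its middle
group is the push-out `(H' × X) / {(t h, -ι h) | h ∈ H}` of `t` and `ι`. -/
def pushout [IsTopologicalAddGroup H'] (E : TopAddExtension G H) (t : H →ₜ+ H') :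
    TopAddExtension G H' where
  X := (H' × E.X) ⧸ E.pushoutSubgroup t
  ι :=
    { toFun := fun y => QuotientAddGroup.mk (y, 0)
      map_zero' := rfl
      map_add' := fun a b => by
        rw [← QuotientAddGroup.mk_add, Prod.mk_add_mk, add_zero]
      continuous_toFun := QuotientAddGroup.continuous_mk.comp (by fun_prop) }
  π :=
    { toAddMonoidHom := QuotientAddGroup.lift (E.pushoutSubgroup t)
        (E.π.toAddMonoidHom.comp (AddMonoidHom.snd H' E.X)) (by
          rintro p hp
          obtain ⟨h, -, h2⟩ := (E.mem_pushoutSubgroup t p).1 hp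
          change E.π p.2 = 0
          rw [← h2, map_neg, E.π_ι, neg_zero])
      continuous_toFun := by
        refine QuotientAddGroup.isOpenQuotientMap_mk.continuous_comp_iff.1 ?_
        exact E.π.continuous_toFun.comp continuous_snd }
  isEmbedding := by
    let f : H' →+ (H' × E.X) ⧸ E.pushoutSubgroup t :=
      (QuotientAddGroup.mk' (E.pushoutSubgroup t)).comp (AddMonoidHom.inl H' E.X)
    change IsEmbedding f
    have hf : ∀ y, f y = QuotientAddGroup.mk (y, 0) := fun _ => rfl
    have hfc : Continuous f := QuotientAddGroup.continuous_mk.comp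
      (Continuous.prodMk continuous_id continuous_const)
    refine ⟨?_, ?_⟩
    · refine (IsTopologicalAddGroup.isInducing_iff_nhds_zero (f := f)).2 ?_
      refine le_antisymm ?_ ?_
      · rw [← Filter.map_le_iff_le_comap]
        have := hfc.tendsto 0
        rwa [map_zero] at this
      · intro U hU
        obtain ⟨V, hV, hVU⟩ := exists_nhds_zero_half hU
        have ht : t ⁻¹' V ∈ 𝓝 (0 : H) :=
          t.continuous_toFun.continuousAt.preimage_mem_nhds (by simpa using hV)
        rw [E.isEmbedding.nhds_eq_comap, map_zero] at ht
        obtain ⟨W, hW, hWV⟩ := Filter.mem_comap.1 ht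
        have hN : V ×ˢ W ∈ 𝓝 (0 : H' × E.X) := prod_mem_nhds hV hW
        have := (QuotientAddGroup.isOpenQuotientMap_mk
          (N := E.pushoutSubgroup t)).isOpenMap.image_mem_nhds hN
        refine Filter.mem_comap.2 ⟨_, this, ?_⟩
        rintro y ⟨⟨a, b⟩, ⟨ha, hb⟩, hab⟩
        rw [hf, QuotientAddGroup.eq, mem_pushoutSubgroup] at hab
        obtain ⟨h, h1, h2⟩ := hab
        simp only [Prod.neg_mk, Prod.mk_add_mk, add_zero] at h1 h2
        have hh : t h ∈ V := hWV (by
          change E.ι h ∈ W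
          rw [neg_inj.1 h2]
          exact hb)
        have : y = a + t h := by rw [h1]; abel
        rw [this]
        exact hVU _ ha _ hh
    · rw [injective_iff_map_eq_zero]
      intro y hy
      rw [hf, QuotientAddGroup.eq_zero_iff, mem_pushoutSubgroup] at hy
      obtain ⟨h, h1, h2⟩ := hy
      rw [neg_eq_zero, map_eq_zero_iff _ E.isEmbedding.injective] at h2
      rw [← show t h = y from h1, h2, map_zero]
  isOpenQuotientMap := by
    refine (QuotientAddGroup.isOpenQuotientMap_mk (N := E.pushoutSubgroup t)).of_comp_iff.1 ?_
    exact E.isOpenQuotientMap.comp ⟨Prod.snd_surjective, continuous_snd, isOpenMap_snd⟩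
  exact := by
    intro q
    obtain ⟨⟨y, x⟩, rfl⟩ := QuotientAddGroup.mk_surjective q
    change E.π x = 0 ↔ _
    constructor
    · intro hx
      obtain ⟨h, rfl⟩ := (E.exact x).1 hx
      refine ⟨y + t h, ?_⟩
      refine QuotientAddGroup.eq.2 ((E.mem_pushoutSubgroup t _).2 ⟨-h, ?_, ?_⟩) <;> simp
    · rintro ⟨z, hz⟩
      obtain ⟨h, -, h2⟩ := (E.mem_pushoutSubgroup t _).1 (QuotientAddGroup.eq.1 hz)
      have : -E.ι h = x := by simpa using h2
      rw [← this, map_neg, E.π_ι, neg_zero]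

/-- A continuous homomorphism from `X` to the middle group of an extension `F`, compatible with
`t` and with the projections, makes `F` equivalent to the push-out extension along `t`. -/
theorem pushout_equivalent [IsTopologicalAddGroup H'] (E : TopAddExtension G H) (t : H →ₜ+ H')
    (F : TopAddExtension G H') (S : E.X →ₜ+ F.X) (h1 : ∀ h, S (E.ι h) = F.ι (t h))
    (h2 : ∀ x, F.π (S x) = E.π x) : Equivalent (E.pushout t) F := by
  let f : (H' × E.X) →+ F.X := F.ι.toAddMonoidHom.coprod S.toAddMonoidHom
  have hf : ∀ p, f p = F.ι p.1 + S p.2 := fun _ => rfl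
  have hfc : Continuous f :=
    (F.ι.continuous_toFun.comp continuous_fst).add (S.continuous_toFun.comp continuous_snd)
  refine ⟨⟨QuotientAddGroup.lift (E.pushoutSubgroup t) f ?_, ?_⟩, fun y => ?_, fun q => ?_⟩
  · intro p hp
    obtain ⟨h, ha, hb⟩ := (E.mem_pushoutSubgroup t p).1 hp
    change f p = 0
    rw [hf, ← ha, ← hb, map_neg, h1, add_neg_cancel]
  · exact QuotientAddGroup.isOpenQuotientMap_mk.continuous_comp_iff.1 hfc
  · change f (y, 0) = F.ι y
    simp [hf]
  · obtain ⟨⟨y, x⟩, rfl⟩ := QuotientAddGroup.mk_surjective q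
    change F.π (f (y, x)) = E.π x
    simp [hf, h2, F.π_ι]

theorem equivalent_of_common [IsTopologicalAddGroup H'] (E : TopAddExtension G H) (t : H →ₜ+ H')
    (F F' : TopAddExtension G H') (S : E.X →ₜ+ F.X) (h1 : ∀ h, S (E.ι h) = F.ι (t h))
    (h2 : ∀ x, F.π (S x) = E.π x) (S' : E.X →ₜ+ F'.X) (h1' : ∀ h, S' (E.ι h) = F'.ι (t h))
    (h2' : ∀ x, F'.π (S' x) = E.π x) : Equivalent F F' :=
  (pushout_equivalent E t F S h1 h2).symm.trans (pushout_equivalent E t F' S' h1' h2')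

end Pushout

section Baer

set_option linter.unusedSectionVars false

variable {G : Type u} {H : Type v} [AddCommGroup G] [TopologicalSpace G]
  [AddCommGroup H] [TopologicalSpace H] [IsTopologicalAddGroup G] [IsTopologicalAddGroup H]

/-- The pull-back of the product extension along the diagonal of `G`. -/
abbrev diagProd (E₁ E₂ : TopAddExtension G H) : TopAddExtension G (H × H) :=
  (E₁.prod E₂).pullback (ContinuousAddMonoidHom.diag G)

/-- The Baer sum `∇ ((E₁ × E₂) Δ)`, with `Δ` the diagonal of `G` and `∇` the addition of `H`. -/
def baerSum (E₁ E₂ : TopAddExtension G H) : TopAddExtension G H :=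
  (E₁.diagProd E₂).pushout (ContinuousAddMonoidHom.add H)

theorem diagProd_mem (E₁ E₂ : TopAddExtension G H) (p : (E₁.diagProd E₂).X) :
    E₁.π p.1.1.1 = p.1.2 ∧ E₂.π p.1.1.2 = p.1.2 :=
  ⟨congrArg Prod.fst p.2, congrArg Prod.snd p.2⟩

/-- The canonical map from the pull-back to the middle group of the Baer sum. -/
def toBaerSum (E₁ E₂ : TopAddExtension G H) : (E₁.diagProd E₂).X →ₜ+ (E₁.baerSum E₂).X where
  toAddMonoidHom := (QuotientAddGroup.mk' ((E₁.diagProd E₂).pushoutSubgroup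
    (ContinuousAddMonoidHom.add H))).comp (AddMonoidHom.inr H (E₁.diagProd E₂).X)
  continuous_toFun := QuotientAddGroup.continuous_mk.comp
    (Continuous.prodMk continuous_const continuous_id)

theorem toBaerSum_ι (E₁ E₂ : TopAddExtension G H) (h : H × H) :
    toBaerSum E₁ E₂ ((E₁.diagProd E₂).ι h) = (E₁.baerSum E₂).ι (h.1 + h.2) := by
  refine QuotientAddGroup.eq.2 ((mem_pushoutSubgroup _ _ _).2 ⟨h, ?_, ?_⟩) <;> simp

theorem π_toBaerSum (E₁ E₂ : TopAddExtension G H) (p : (E₁.diagProd E₂).X) :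
    (E₁.baerSum E₂).π (toBaerSum E₁ E₂ p) = p.1.2 := rfl

/-- Mapping two homomorphisms that agree after projection to `G` into the Baer sum. -/
def liftBaerSum {A : Type*} [AddCommGroup A] [TopologicalSpace A] (E₁ E₂ : TopAddExtension G H)
    (f₁ : A →ₜ+ E₁.X) (f₂ : A →ₜ+ E₂.X) (hf : ∀ a, E₂.π (f₂ a) = E₁.π (f₁ a)) :
    A →ₜ+ (E₁.baerSum E₂).X :=
  (toBaerSum E₁ E₂).comp
    { toFun := fun a => ⟨((f₁ a, f₂ a), E₁.π (f₁ a)), Prod.ext rfl (hf a)⟩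
      map_zero' := by
        apply Subtype.ext
        simp only [map_zero]
        rfl
      map_add' := fun a b => by
        apply Subtype.ext
        simp only [map_add]
        rfl
      continuous_toFun := by
        refine Continuous.subtype_mk ?_ _
        exact (f₁.continuous_toFun.prodMk f₂.continuous_toFun).prodMk
          (E₁.π.continuous_toFun.comp f₁.continuous_toFun) }

theorem liftBaerSum_ι {A : Type*} [AddCommGroup A] [TopologicalSpace A]
    (E₁ E₂ : TopAddExtension G H) (f₁ : A →ₜ+ E₁.X) (f₂ : A →ₜ+ E₂.X)
    (hf : ∀ a, E₂.π (f₂ a) = E₁.π (f₁ a)) (a : A) (h₁ h₂ : H) (e₁ : f₁ a = E₁.ι h₁)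
    (e₂ : f₂ a = E₂.ι h₂) : liftBaerSum E₁ E₂ f₁ f₂ hf a = (E₁.baerSum E₂).ι (h₁ + h₂) := by
  rw [← toBaerSum_ι E₁ E₂ (h₁, h₂)]
  refine congrArg (toBaerSum E₁ E₂) (Subtype.ext (Prod.ext (Prod.ext e₁ e₂) ?_))
  change E₁.π (f₁ a) = 0
  rw [e₁, E₁.π_ι]

theorem π_liftBaerSum {A : Type*} [AddCommGroup A] [TopologicalSpace A]
    (E₁ E₂ : TopAddExtension G H) (f₁ : A →ₜ+ E₁.X) (f₂ : A →ₜ+ E₂.X)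
    (hf : ∀ a, E₂.π (f₂ a) = E₁.π (f₁ a)) (a : A) :
    (E₁.baerSum E₂).π (liftBaerSum E₁ E₂ f₁ f₂ hf a) = E₁.π (f₁ a) := rfl

/-- The first projection of the pull-back. -/
def diagFst (E₁ E₂ : TopAddExtension G H) : (E₁.diagProd E₂).X →ₜ+ E₁.X where
  toFun p := p.1.1.1
  map_zero' := rfl
  map_add' _ _ := rfl
  continuous_toFun := continuous_fst.comp (continuous_fst.comp continuous_subtype_val)

/-- The second projection of the pull-back. -/
def diagSnd (E₁ E₂ : TopAddExtension G H) : (E₁.diagProd E₂).X →ₜ+ E₂.X where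
  toFun p := p.1.1.2
  map_zero' := rfl
  map_add' _ _ := rfl
  continuous_toFun := continuous_snd.comp (continuous_fst.comp continuous_subtype_val)

theorem π_diagFst (E₁ E₂ : TopAddExtension G H) (p : (E₁.diagProd E₂).X) :
    E₁.π (diagFst E₁ E₂ p) = (E₁.diagProd E₂).π p := (diagProd_mem E₁ E₂ p).1

theorem π_diagSnd (E₁ E₂ : TopAddExtension G H) (p : (E₁.diagProd E₂).X) :
    E₂.π (diagSnd E₁ E₂ p) = (E₁.diagProd E₂).π p := (diagProd_mem E₁ E₂ p).2

theorem baerSum_equivalent (E₁ E₂ F : TopAddExtension G H) (S : (E₁.diagProd E₂).X →ₜ+ F.X)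
    (h1 : ∀ h, S ((E₁.diagProd E₂).ι h) = F.ι (h.1 + h.2))
    (h2 : ∀ p, F.π (S p) = (E₁.diagProd E₂).π p) : Equivalent (E₁.baerSum E₂) F :=
  pushout_equivalent _ (ContinuousAddMonoidHom.add H) F S h1 h2

theorem baerSum_congr {E₁ E₂ F₁ F₂ : TopAddExtension G H} (h₁ : Equivalent E₁ F₁)
    (h₂ : Equivalent E₂ F₂) : Equivalent (E₁.baerSum E₂) (F₁.baerSum F₂) := by
  obtain ⟨T₁, a₁, b₁⟩ := h₁
  obtain ⟨T₂, a₂, b₂⟩ := h₂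
  refine baerSum_equivalent _ _ _ (liftBaerSum F₁ F₂ (T₁.comp (diagFst E₁ E₂))
    (T₂.comp (diagSnd E₁ E₂)) fun p => ?_) (fun h => ?_) fun p => ?_
  · exact (b₂ _).trans ((π_diagSnd E₁ E₂ p).trans
      ((π_diagFst E₁ E₂ p).symm.trans (b₁ _).symm))
  · exact liftBaerSum_ι _ _ _ _ _ _ _ _ (a₁ h.1) (a₂ h.2)
  · exact (b₁ _).trans (π_diagFst E₁ E₂ p)

theorem baerSum_comm (E₁ E₂ : TopAddExtension G H) :
    Equivalent (E₁.baerSum E₂) (E₂.baerSum E₁) := by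
  refine baerSum_equivalent _ _ _ (liftBaerSum E₂ E₁ (diagSnd E₁ E₂) (diagFst E₁ E₂)
    fun p => ?_) (fun h => ?_) fun p => ?_
  · rw [π_diagFst, π_diagSnd]
  · rw [add_comm]
    exact liftBaerSum_ι _ _ _ _ _ _ _ _ rfl rfl
  · rw [π_liftBaerSum, π_diagSnd]

theorem baerSum_trivial (E : TopAddExtension G H) :
    Equivalent (E.baerSum (trivial G H)) E := by
  refine baerSum_equivalent _ _ _ (diagFst E (trivial G H) + E.ι.comp
    ((ContinuousAddMonoidHom.fst H G).comp (diagSnd E (trivial G H)))) (fun h => ?_) fun p => ?_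
  · rw [map_add]
    rfl
  · rw [ContinuousAddMonoidHom.add_apply, map_add, π_diagFst]
    change _ + E.π (E.ι _) = _
    rw [E.π_ι, add_zero]

theorem baerSum_neg (E : TopAddExtension G H) :
    Equivalent (E.neg.baerSum E) (trivial G H) := by
  let f : (E.neg.diagProd E).X →ₜ+ E.X := diagFst E.neg E
  let d : (E.neg.diagProd E).X →ₜ+ E.X :=
    diagSnd E.neg E + (ContinuousAddMonoidHom.neg E.X).comp f
  have hd : ∀ p, d p = diagSnd E.neg E p - f p := fun p => by
    rw [sub_eq_add_neg]
    rfl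
  have hk : ∀ p, ∃ k, E.ι k = d p := fun p => (E.exact _).1 (by
    rw [hd, map_sub, π_diagSnd, show E.π (f p) = _ from π_diagFst E.neg E p,
      sub_self])
  choose k hk using hk
  have hinj := E.isEmbedding.injective
  let κ : (E.neg.diagProd E).X →ₜ+ H :=
    { toFun := k
      map_zero' := hinj (by rw [hk, map_zero, map_zero])
      map_add' := fun a b => hinj (by rw [hk, map_add, map_add, hk, hk])
      continuous_toFun := by
        rw [E.isEmbedding.continuous_iff]
        exact d.continuous_toFun.congr fun p => (hk p).symm }
  refine baerSum_equivalent _ _ _ (κ.prod (E.neg.diagProd E).π) (fun h => ?_) fun p => rfl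
  refine Prod.ext ?_ (π_ι _ _)
  change k _ = h.1 + h.2
  apply hinj
  rw [hk, hd]
  change E.ι h.2 - E.ι (-h.1) = _
  simp [add_comm]

theorem baerSum_assoc (E₁ E₂ E₃ : TopAddExtension G H) :
    Equivalent ((E₁.baerSum E₂).baerSum E₃) (E₁.baerSum (E₂.baerSum E₃)) := by
  let P := (E₁.prod (E₂.prod E₃)).pullback
    ((ContinuousAddMonoidHom.id G).prod (ContinuousAddMonoidHom.diag G))
  have hP : ∀ p : P.X, E₁.π p.1.1.1 = p.1.2 ∧ E₂.π p.1.1.2.1 = p.1.2 ∧ E₃.π p.1.1.2.2 = p.1.2 :=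
    fun p => ⟨congrArg Prod.fst p.2, congrArg (fun q => q.2.1) p.2,
      congrArg (fun q => q.2.2) p.2⟩
  let t : H × H × H →ₜ+ H := (ContinuousAddMonoidHom.add H).comp
    ((ContinuousAddMonoidHom.id H).prodMap (ContinuousAddMonoidHom.add H))
  have ht : ∀ h, t h = h.1 + (h.2.1 + h.2.2) := fun _ => rfl
  let q : P.X →ₜ+ E₁.X × E₂.X × E₃.X :=
    { toFun := fun p => p.1.1
      map_zero' := rfl
      map_add' := fun _ _ => rfl
      continuous_toFun := continuous_fst.comp continuous_subtype_val }
  let q₁ : P.X →ₜ+ E₁.X := (ContinuousAddMonoidHom.fst _ _).comp q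
  let q₂ : P.X →ₜ+ E₂.X :=
    ((ContinuousAddMonoidHom.fst _ _).comp (ContinuousAddMonoidHom.snd _ _)).comp q
  let q₃ : P.X →ₜ+ E₃.X :=
    ((ContinuousAddMonoidHom.snd _ _).comp (ContinuousAddMonoidHom.snd _ _)).comp q
  have c₁₂ : ∀ p, E₂.π (q₂ p) = E₁.π (q₁ p) := fun p => (hP p).2.1.trans (hP p).1.symm
  have c₂₃ : ∀ p, E₃.π (q₃ p) = E₂.π (q₂ p) := fun p => (hP p).2.2.trans (hP p).2.1.symm
  have c₁₃ : ∀ p, E₃.π (q₃ p) = (E₁.baerSum E₂).π (liftBaerSum E₁ E₂ q₁ q₂ c₁₂ p) :=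
    fun p => (c₂₃ p).trans (c₁₂ p)
  have c₁₂' : ∀ p, (E₂.baerSum E₃).π (liftBaerSum E₂ E₃ q₂ q₃ c₂₃ p) = E₁.π (q₁ p) := c₁₂
  refine equivalent_of_common P t _ _
    (liftBaerSum _ _ (liftBaerSum E₁ E₂ q₁ q₂ c₁₂) q₃ c₁₃) (fun h => ?_) (fun p => (hP p).1)
    (liftBaerSum _ _ q₁ (liftBaerSum E₂ E₃ q₂ q₃ c₂₃) c₁₂') (fun h => ?_) (fun p => (hP p).1)
  · rw [ht, ← add_assoc]
    exact liftBaerSum_ι _ _ _ _ _ _ _ _ (liftBaerSum_ι _ _ _ _ _ _ _ _ rfl rfl) rfl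
  · rw [ht]
    exact liftBaerSum_ι _ _ _ _ _ _ _ _ rfl (liftBaerSum_ι _ _ _ _ _ _ _ _ rfl rfl)

theorem neg_congr {E F : TopAddExtension G H} (h : Equivalent E F) :
    Equivalent E.neg F.neg := by
  obtain ⟨T, a, b⟩ := h
  exact ⟨T, fun h => a (-h), b⟩

end Baer

end TopAddExtension

/-- `Ext(G, H)`: the equivalence classes of extensions of topological abelian groups
`0 → H → X → G → 0`. -/
def TopExt (G : Type u) (H : Type v) [AddCommGroup G] [TopologicalSpace G]
    [AddCommGroup H] [TopologicalSpace H] : Type (max (u + 1) (v + 1)) :=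
  Quotient (TopAddExtension.setoid G H)

namespace TopExt

variable {G : Type u} {H : Type v} [AddCommGroup G] [TopologicalSpace G]
  [AddCommGroup H] [TopologicalSpace H] [IsTopologicalAddGroup G] [IsTopologicalAddGroup H]

/-- Addition in `Ext(G, H)` is the Baer sum. -/
instance : Add (TopExt G H) where
  add := Quotient.map₂ TopAddExtension.baerSum
    fun _ _ h₁ _ _ h₂ => TopAddExtension.baerSum_congr h₁ h₂

instance : Zero (TopExt G H) where
  zero := Quotient.mk _ (TopAddExtension.trivial G H)

instance : Neg (TopExt G H) where
  neg := Quotient.map TopAddExtension.neg fun _ _ h => TopAddExtension.neg_congr h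

/-- `Ext(G, H)` is an abelian group under the Baer sum. -/
instance : AddCommGroup (TopExt G H) where
  add_assoc := by
    rintro ⟨E₁⟩ ⟨E₂⟩ ⟨E₃⟩
    exact Quotient.sound (TopAddExtension.baerSum_assoc E₁ E₂ E₃)
  add_comm := by
    rintro ⟨E₁⟩ ⟨E₂⟩
    exact Quotient.sound (TopAddExtension.baerSum_comm E₁ E₂)
  zero_add := by
    rintro ⟨E⟩
    exact Quotient.sound ((TopAddExtension.baerSum_comm _ E).trans
      (TopAddExtension.baerSum_trivial E))
  add_zero := by
    rintro ⟨E⟩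
    exact Quotient.sound (TopAddExtension.baerSum_trivial E)
  neg_add_cancel := by
    rintro ⟨E⟩
    exact Quotient.sound (TopAddExtension.baerSum_neg E)
  nsmul := nsmulRec
  zsmul := zsmulRec

end TopExt

/-! The isomorphism is restriction, that is, pull-back along `D → G`. It respects Baer sums because
the universal property of the push-out reduces the comparison to a map out of a pull-back. Its
bijectivity is a matter of taking limits and rests on two properties of a Čech-complete group `H`.

First, by a Baire category argument `H` is closed in every Hausdorff abelian group in which it is
embedded. Hence a Cauchy filter on the middle group of an extension of `G` by `H` converges as soon
as its image in `G` does: its limit in the completion differs from a point of the middle group by an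
element of the closure of `H`, which is `H`. So a morphism between restrictions to `D` extends by
continuity, which gives injectivity.

Second, `0` has a sequence of neighbourhoods in `H` that converges to a compact set. This is needed
for surjectivity. Given `0 → H → X → D → 0`, let `Z` be the completion of `X` and take the closure
in `Z × G` of the graph of `X → G`. Its projection to `G` has kernel `H`, since `H` is closed in
`Z`. The difficult point is that it is onto `G`: every `g` must be the limit of the image of a
Cauchy filter on `X`. Countably many successive lifts confine a filter over `g` to sets whose
differences are small modulo a compact set, and an ultrafilter removes this compact ambiguity. -/

open Filter Set

/-! ### Čech-complete spaces and groups -/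

namespace CechCompleteSpace

variable {X : Type*} [TopologicalSpace X] [CechCompleteSpace X]

theorem exists_isOpen_iInter (X : Type*) [TopologicalSpace X] [CechCompleteSpace X] :
    ∃ O : ℕ → Set (StoneCech X), (∀ n, IsOpen (O n)) ∧
      range (stoneCechUnit : X → StoneCech X) = ⋂ n, O n :=
  (isGδ_range (X := X)).eq_iInter_nat

/-- Every point of a Čech-complete space has a sequence of neighbourhoods that converges to a
compact set. -/
theorem exists_isCompact_nhds_seq (p : X) :
    ∃ K : Set X, IsCompact K ∧ ∃ B : ℕ → Set X, (∀ n, B n ∈ 𝓝 p) ∧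
      ∀ V, IsOpen V → K ⊆ V → ∃ n, B n ⊆ V := by
  have := t35Space (X := X)
  obtain ⟨O, hO, hr⟩ := exists_isOpen_iInter X
  have hp : ∀ n, O n ∈ 𝓝 (stoneCechUnit p) := fun n =>
    (hO n).mem_nhds (mem_iInter.1 (hr ▸ mem_range_self p) n)
  choose C hC hCc hCO using fun n => exists_mem_nhds_isClosed_subset (hp n)
  let C' : ℕ → Set (StoneCech X) := fun n => ⋂ i ≤ n, C i
  have hC' : ∀ n, C' n ∈ 𝓝 (stoneCechUnit p) := fun n =>
    (biInter_mem (finite_le_nat n)).2 fun i _ => hC i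
  have hC'c : ∀ n, IsClosed (C' n) := fun n => isClosed_biInter fun i _ => hCc i
  have hanti : Antitone C' := fun m n hmn => biInter_subset_biInter_left fun i hi => le_trans hi hmn
  have hsub : ⋂ n, C' n ⊆ range (stoneCechUnit : X → StoneCech X) := by
    rw [hr]
    exact iInter_mono fun n x hx => hCO n (mem_iInter₂.1 hx n le_rfl)
  refine ⟨stoneCechUnit ⁻¹' ⋂ n, C' n, ?_, fun n => stoneCechUnit ⁻¹' C' n,
    fun n => continuous_stoneCechUnit.continuousAt.preimage_mem_nhds (hC' n), ?_⟩
  -- The intersection lies inside the image of `X`, so its compactness in the Stone-Čech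
  -- compactification passes to `X`.
  · exact (isInducing_stoneCechUnit.isCompact_preimage_iff hsub).2
      (isClosed_iInter hC'c).isCompact
  · intro V hV hKV
    obtain ⟨V', hV', rfl⟩ := isInducing_stoneCechUnit.isOpen_iff.1 hV
    obtain ⟨n, hn⟩ := exists_subset_nhds_of_isCompact' hanti.directed_ge
      (fun n => (hC'c n).isCompact) hC'c (U := V') (fun x hx => by
        obtain ⟨y, rfl⟩ := hsub hx
        exact hV'.mem_nhds (hKV hx))
    exact ⟨n, preimage_mono hn⟩

/-- A dense `G_δ` subset of a compact Hausdorff space is Baire. -/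
theorem baireSpace : BaireSpace X := by
  have := t35Space (X := X)
  have : BaireSpace (range (stoneCechUnit : X → StoneCech X)) :=
    (isGδ_range (X := X)).baireSpace_of_dense denseRange_stoneCechUnit
  exact isEmbedding_stoneCechUnit.toHomeomorph.symm.isOpenQuotientMap.baireSpace

/-- A Čech-complete subspace of a Hausdorff space is a `G_δ` subset of its closure. -/
theorem exists_isOpen_closure_inter {Z : Type*} [TopologicalSpace Z] [T2Space Z] {j : X → Z}
    (hj : IsEmbedding j) : ∃ W : ℕ → Set Z, (∀ n, IsOpen (W n)) ∧ (∀ n x, j x ∈ W n) ∧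
      ∀ z ∈ closure (range j), (∀ n, z ∈ W n) → z ∈ range j := by
  have := t35Space (X := X)
  obtain ⟨O, hO, hr⟩ := exists_isOpen_iInter X
  -- The closure ensures that an ultrafilter on `X` containing `j ⁻¹' V` has its Stone-Čech limit in
  -- `O n`. An ultrafilter converging to `z` along `j` therefore has its limit in every `O n`, hence
  -- in `X`, and this limit is mapped to `z`.
  refine ⟨fun n => ⋃₀ {V | IsOpen V ∧ closure (stoneCechUnit '' (j ⁻¹' V)) ⊆ O n},
    fun n => isOpen_sUnion fun V hV => hV.1, fun n x => ?_, fun z hz hW => ?_⟩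
  · obtain ⟨C, hC, hCc, hCO⟩ := exists_mem_nhds_isClosed_subset
      ((hO n).mem_nhds (mem_iInter.1 (hr ▸ mem_range_self x) n))
    have hCx := continuous_stoneCechUnit.continuousAt.preimage_mem_nhds hC
    rw [hj.nhds_eq_comap] at hCx
    obtain ⟨V, hV, hVC⟩ := mem_comap.1 hCx
    obtain ⟨V', hV'V, hV', hx⟩ := mem_nhds_iff.1 hV
    refine ⟨V', ⟨hV', (closure_minimal ?_ hCc).trans hCO⟩, hx⟩
    rintro _ ⟨y, hy, rfl⟩
    exact hVC (hV'V hy)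
  · have hne : (comap j (𝓝 z)).NeBot := by
      refine comap_neBot_iff.2 fun t ht => ?_
      obtain ⟨_, hxt, x, rfl⟩ := mem_closure_iff_nhds.1 hz t ht
      exact ⟨x, hxt⟩
    let U := Ultrafilter.of (comap j (𝓝 z))
    have hU : ↑U ≤ comap j (𝓝 z) := Ultrafilter.of_le _
    obtain ⟨y, -, hy⟩ := isCompact_univ.ultrafilter_le_nhds (U.map stoneCechUnit)
      (by simp)
    have hyO : y ∈ ⋂ n, O n := by
      refine mem_iInter.2 fun n => ?_
      obtain ⟨V, ⟨hVo, hV⟩, hzV⟩ := hW n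
      refine hV (mem_closure_iff_ultrafilter.2 ⟨U.map stoneCechUnit, ?_, hy⟩)
      have : j ⁻¹' V ∈ U := hU (preimage_mem_comap (hVo.mem_nhds hzV))
      exact Ultrafilter.mem_map.2 (mem_of_superset this (subset_preimage_image _ _))
    rw [← hr] at hyO
    obtain ⟨x, rfl⟩ := hyO
    have hx : ↑U ≤ 𝓝 x := by
      rw [isInducing_stoneCechUnit.nhds_eq_comap]
      exact map_le_iff_le_comap.1 hy
    have h1 : Tendsto j U (𝓝 (j x)) := (hj.continuous.tendsto x).mono_left hx
    have h2 : Tendsto j U (𝓝 z) := map_le_iff_le_comap.2 hU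
    exact ⟨x, tendsto_nhds_unique h1 h2⟩

/-- A Čech-complete abelian group is closed in every Hausdorff group in which it is embedded. -/
theorem isClosed_range {H Z : Type*} [AddCommGroup H] [TopologicalSpace H] [CechCompleteSpace H]
    [AddCommGroup Z] [TopologicalSpace Z] [IsTopologicalAddGroup Z] [T2Space Z] (j : H →+ Z)
    (hj : IsEmbedding j) : IsClosed (range j) := by
  obtain ⟨W, hWo, hjW, hW⟩ := exists_isOpen_closure_inter hj
  have := baireSpace (X := H)
  have hcl : closure (range j) = (j.range.topologicalClosure : Set Z) := by simp
  refine isClosed_of_closure_subset fun z hz => ?_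
  have hsub : ∀ h, z - j h ∈ closure (range j) := fun h => by
    rw [hcl] at hz ⊢
    exact sub_mem hz (j.range.le_topologicalClosure ⟨h, rfl⟩)
  -- By Baire, some `z - j h` lies in all `W n`; being in the closure of the image, it is in the
  -- image, and so is `z`.
  have hdense : Dense (⋂ n, {h | z - j h ∈ W n}) := by
    refine dense_iInter_of_isOpen (fun n => (hWo n).preimage
      (continuous_const.sub hj.continuous)) fun n => ?_
    refine dense_iff_inter_open.2 fun N hN hne => ?_
    obtain ⟨h₀, hh₀⟩ := hne
    obtain ⟨N', hN', rfl⟩ := hj.isOpen_iff.1 hN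
    have hopen : IsOpen {x | z - x ∈ N'} := hN'.preimage (by fun_prop)
    -- The reflection `x ↦ z - x` is applied twice: `z - j h₁` lies in `N'` and is reflected to `j
    -- h₁ ∈ W n`. Points of the image near `z - j h₁` thus satisfy both conditions.
    obtain ⟨_, hx, h₁, rfl⟩ := mem_closure_iff.1 (hsub h₀) _ hopen (by simpa using hh₀)
    have hopen' : IsOpen (N' ∩ {x | z - x ∈ W n}) :=
      hN'.inter ((hWo n).preimage (by fun_prop))
    obtain ⟨_, ⟨hx1, hx2⟩, h, rfl⟩ := mem_closure_iff.1 (hsub h₁) _ hopen'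
      ⟨hx, by simpa using hjW n h₁⟩
    exact ⟨h, hx1, hx2⟩
  obtain ⟨h, hh⟩ := hdense.nonempty
  obtain ⟨k, hk⟩ := hW _ (hsub h) fun n => mem_iInter.1 hh n
  exact ⟨k + h, by rw [map_add, hk]; abel⟩

end CechCompleteSpace

/-! ### Cauchy ultrafilters over limit points of the image -/

section Lift

/-- A countable scale of neighbourhoods for counting errors: each step down the sequence pays for
one addition. -/
theorem exists_seq_symm_nhds_zero {X : Type*} [AddCommGroup X] [TopologicalSpace X]
    [IsTopologicalAddGroup X] (A : ℕ → Set X) (hA : ∀ n, A n ∈ 𝓝 0) :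
    ∃ U : ℕ → Set X, (∀ n, U n ∈ 𝓝 0) ∧ (∀ n, U n ⊆ A n) ∧ (∀ n, ∀ x ∈ U n, -x ∈ U n) ∧
      ∀ n, ∀ x ∈ U (n + 1), ∀ y ∈ U (n + 1), x + y ∈ U n := by
  have key : ∀ B ∈ 𝓝 (0 : X), ∃ V ∈ 𝓝 (0 : X), (∀ x ∈ V, -x ∈ V) ∧
      ∀ x ∈ V, ∀ y ∈ V, x + y ∈ B := by
    intro B hB
    obtain ⟨V, hV, hVB⟩ := exists_nhds_zero_half hB
    refine ⟨V ∩ -V, inter_mem hV (neg_mem_nhds_zero X hV), fun x hx => ⟨hx.2, ?_⟩,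
      fun x hx y hy => hVB x hx.1 y hy.1⟩
    simpa using hx.1
  choose! V hV hVs hVadd using key
  let U : ℕ → Set X := fun n => Nat.rec (V (A 0)) (fun n S => V (S ∩ A (n + 1))) n
  have hU : ∀ n, U n ∈ 𝓝 0 := by
    intro n
    induction n with
    | zero => exact hV _ (hA 0)
    | succ n ih => exact hV _ (inter_mem ih (hA _))
  have hsub : ∀ B ∈ 𝓝 (0 : X), V B ⊆ B := fun B hB x hx => by
    simpa using hVadd B hB x hx 0 (mem_of_mem_nhds (hV B hB))
  refine ⟨U, hU, fun n => ?_, fun n => ?_, fun n x hx y hy => ?_⟩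
  · cases n with
    | zero => exact hsub _ (hA 0)
    | succ n => exact (hsub _ (inter_mem (hU n) (hA _))).trans inter_subset_right
  · cases n with
    | zero => exact hVs _ (hA 0)
    | succ n => exact hVs _ (inter_mem (hU n) (hA _))
  · exact (hVadd _ (inter_mem (hU n) (hA (n + 1))) x hx y hy).1

variable {X G H : Type*} [AddCommGroup X] [TopologicalSpace X] [IsTopologicalAddGroup X]
  [AddCommGroup G] [TopologicalSpace G] [IsTopologicalAddGroup G]
  [AddCommGroup H] [TopologicalSpace H] [IsTopologicalAddGroup H]

/-- A homomorphism is open onto its image. -/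
def AddMonoidHom.IsOpenOntoRange (f : X →+ G) : Prop :=
  ∀ V ∈ 𝓝 (0 : X), ∃ O ∈ 𝓝 (0 : G), ∀ x, f x ∈ O → ∃ v ∈ V, f v = f x

/-- An ultrafilter that is small up to the translates of a compact set is Cauchy. -/
theorem Ultrafilter.tendsto_sub_nhds_zero (U : Ultrafilter X) {K : Set X} (hK : IsCompact K)
    (h : ∀ V ∈ 𝓝 (0 : X), ∃ A ∈ U, ∀ x ∈ A, ∀ y ∈ A, ∃ k ∈ K, x - y - k ∈ V) :
    Tendsto (fun p : X × X => p.1 - p.2) ((U : Filter X) ×ˢ (U : Filter X)) (𝓝 0) := by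
  intro V hV
  obtain ⟨V₁, hV₁, hV₁V⟩ := exists_nhds_half_neg hV
  obtain ⟨V₂, hV₂, hV₂V⟩ := exists_nhds_zero_half hV₁
  obtain ⟨A, hA, hAK⟩ := h V₂ hV₂
  -- With `a` fixed, `A` lies in `a + K + V₂`, hence in finitely many translates of `V₁`. The
  -- ultrafilter contains one of these, and its differences lie in `V`.
  obtain ⟨a, ha⟩ := U.nonempty_of_mem hA
  obtain ⟨t, -, ht⟩ := hK.elim_nhds_subcover (fun k => {x | x - k ∈ V₂}) fun k _ =>
    ContinuousAt.preimage_mem_nhds (f := fun x => x - k) (by fun_prop) (by simpa using hV₂)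
  have hcov : (⋃ k ∈ (t : Set X), {x | x - a - k ∈ V₁}) ∈ U := by
    refine mem_of_superset hA fun x hx => ?_
    obtain ⟨k, hk, hxk⟩ := hAK x hx a ha
    obtain ⟨k', hk', hkk'⟩ := mem_iUnion₂.1 (ht hk)
    refine mem_iUnion₂.2 ⟨k', hk', ?_⟩
    have := hV₂V _ hxk _ hkk'
    change x - a - k' ∈ V₁
    rwa [sub_add_sub_cancel] at this
  obtain ⟨k, -, hk⟩ := (Ultrafilter.finite_biUnion_mem_iff t.finite_toSet).1 hcov
  refine Filter.mem_map.2 (Filter.mem_of_superset (prod_mem_prod hk hk) ?_)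
  rintro ⟨x, y⟩ ⟨hx, hy⟩
  have := hV₁V _ hx _ hy
  change x - y ∈ V
  rwa [sub_sub_sub_cancel_right, sub_sub_sub_cancel_right] at this

/-- If the kernel of a homomorphism `f` that is open onto its image is Čech-complete, then every
point in the closure of the image of `f` is the limit of the image of a Cauchy ultrafilter. -/
theorem AddMonoidHom.IsOpenOntoRange.exists_ultrafilter [CechCompleteSpace H] {f : X →+ G}
    (hf : f.IsOpenOntoRange) (ι : H →+ X) (hι : IsEmbedding ι)
    (hker : ∀ x, f x = 0 → x ∈ Set.range ι) {g : G} (hg : g ∈ closure (Set.range f)) :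
    ∃ U : Ultrafilter X, Tendsto (fun p : X × X => p.1 - p.2)
      ((U : Filter X) ×ˢ (U : Filter X)) (𝓝 0) ∧ Tendsto f U (𝓝 g) := by
  obtain ⟨K, hK, B, hB, hKB⟩ := CechCompleteSpace.exists_isCompact_nhds_seq (0 : H)
  have hA : ∀ n, ∃ A ∈ 𝓝 (0 : X), ι ⁻¹' A ⊆ B n := fun n => by
    have := hB n
    rwa [hι.nhds_eq_comap, map_zero, mem_comap] at this
  choose A hA hAB using hA
  obtain ⟨U, hU, hUA, hUneg, hUadd⟩ := exists_seq_symm_nhds_zero A hA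
  have hU0 : ∀ n, 0 ∈ U n := fun n => mem_of_mem_nhds (hU n)
  choose O' hO' hfO' using fun n => hf (U n) (hU n)
  obtain ⟨O, hO, hOO', hOneg, hOadd⟩ := exists_seq_symm_nhds_zero O' hO'
  have happrox : ∀ N ∈ 𝓝 (0 : G), ∃ d, f d - g ∈ N := fun N hN => by
    have : {y | y - g ∈ N} ∈ 𝓝 g :=
      ContinuousAt.preimage_mem_nhds (f := fun y => y - g) (by fun_prop) (by simpa using hN)
    obtain ⟨_, hy, d, rfl⟩ := mem_closure_iff_nhds.1 hg _ this
    exact ⟨d, hy⟩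
  -- The index drops by one because `f d - f x` is a difference of two errors from `O (n + 1)`.
  have hlift : ∀ n x d, f x - g ∈ O (n + 1) → f d - g ∈ O (n + 1) →
      ∃ v ∈ U n, f (x + v) = f d := by
    intro n x d hx hd
    obtain ⟨v, hv, hfv⟩ := hfO' n (d - x) (hOO' n (by
      have := hOadd n _ hd _ (hOneg _ _ hx)
      rwa [← sub_eq_add_neg, sub_sub_sub_cancel_right, ← map_sub] at this))
    exact ⟨v, hv, by rw [map_add, hfv, map_sub]; abel⟩
  have hOanti : ∀ n, O (n + 1) ⊆ O n := fun n y hy => by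
    simpa using hOadd n y hy 0 (mem_of_mem_nhds (hO _))
  have hstep : ∀ n x, f x - g ∈ O (n + 1) → ∃ y, f y - g ∈ O (n + 2) ∧ y - x ∈ U n := by
    intro n x hx
    obtain ⟨d, hd⟩ := happrox _ (hO (n + 2))
    obtain ⟨v, hv, hfv⟩ := hlift n x d hx (hOanti _ hd)
    exact ⟨x + v, by rwa [hfv], by simpa using hv⟩
  choose! s hs hsU using hstep
  obtain ⟨x₀, hx₀⟩ := happrox _ (hO 1)
  let x : ℕ → X := fun n => Nat.rec x₀ (fun n y => s n y) n
  have hx : ∀ n, f (x n) - g ∈ O (n + 1) := by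
    intro n
    induction n with
    | zero => exact hx₀
    | succ n ih => exact hs n _ ih
  have hxU : ∀ n, x (n + 1) - x n ∈ U n := fun n => hsU n _ (hx n)
  -- Two summands make `S` decreasing: one absorbs `x (n + 1) - x n`, the other the sum of two
  -- elements of `U (n + 1)`.
  let S : ℕ → Set X := fun n => {y | ∃ a ∈ U n, ∃ b ∈ U n, y = x n + (a + b)}
  have hSanti : Antitone S := antitone_nat_of_succ_le fun n => by
    rintro _ ⟨a, ha, b, hb, rfl⟩
    exact ⟨_, hxU n, _, hUadd n a ha b hb, by abel⟩
  let L : Filter X := ⨅ n, comap f (𝓝 g) ⊓ 𝓟 (S n)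
  -- Every value `f d` close enough to `g` is also attained on `x n + U n`, so `S n` meets the
  -- preimage of each neighbourhood of `g`.
  have hL : L.NeBot := by
    refine iInf_neBot_of_directed (Antitone.directed_ge fun m n hmn =>
      inf_le_inf_left _ (principal_mono.2 (hSanti hmn))) fun n => ?_
    refine inf_principal_neBot_iff.2 fun T hT => ?_
    obtain ⟨N, hN, hNT⟩ := mem_comap.1 hT
    have hN' : {y | g + y ∈ N} ∈ 𝓝 (0 : G) :=
      ContinuousAt.preimage_mem_nhds (f := fun y => g + y) (by fun_prop) (by simpa using hN)
    obtain ⟨d, hd, hdO⟩ := happrox _ (inter_mem hN' (hO (n + 1)))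
    obtain ⟨v, hv, hfv⟩ := hlift n (x n) d (hx n) hdO
    refine ⟨x n + v, hNT ?_, v, hv, 0, hU0 n, by rw [add_zero]⟩
    change f _ ∈ N
    rw [hfv]
    simpa using hd
  have hUL : ↑(Ultrafilter.of L) ≤ L := Ultrafilter.of_le L
  have hSmem : ∀ n, S n ∈ Ultrafilter.of L := fun n =>
    hUL (mem_iInf_of_mem n (mem_inf_of_right (mem_principal_self _)))
  have hlim : Tendsto f (Ultrafilter.of L) (𝓝 g) :=
    map_le_iff_le_comap.2 (hUL.trans ((iInf_le _ 0).trans inf_le_left))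
  refine ⟨Ultrafilter.of L, Ultrafilter.tendsto_sub_nhds_zero _ (hK.image hι.continuous) ?_, hlim⟩
  intro V hV
  obtain ⟨V₁, hV₁, hV₁V⟩ := exists_nhds_zero_half hV
  have hV₁ι : ι ⁻¹' V₁ ∈ 𝓝 (0 : H) :=
    hι.continuous.continuousAt.preimage_mem_nhds (by simpa using hV₁)
  obtain ⟨n, hn⟩ := hKB (⋃ k ∈ K, {h | h - k ∈ interior (ι ⁻¹' V₁)})
    (isOpen_biUnion fun k _ => isOpen_interior.preimage (by fun_prop))
    (fun k hk => mem_iUnion₂.2 ⟨k, hk, by simpa using mem_interior_iff_mem_nhds.2 hV₁ι⟩)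
  obtain ⟨O₂, hO₂, hfO₂⟩ := hf (V₁ ∩ U (n + 1)) (inter_mem hV₁ (hU _))
  obtain ⟨O₃, hO₃, hO₃O₂⟩ := exists_nhds_half_neg hO₂
  have hO₃g : {y | y - g ∈ O₃} ∈ 𝓝 g :=
    ContinuousAt.preimage_mem_nhds (f := fun y => y - g) (by fun_prop) (by simpa using hO₃)
  -- A difference of two points of `S (n + 3)` involves four elements of `U (n + 3)`, so it lies in
  -- `U (n + 1)`. Subtracting the small `v` with the same image lands in the kernel and in `U n`,
  -- hence in `B n`, which is close to `K`.
  refine ⟨f ⁻¹' {y | y - g ∈ O₃} ∩ S (n + 3), inter_mem (hlim hO₃g) (hSmem _), ?_⟩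
  rintro y ⟨hy, a, ha, b, hb, hyab⟩ z ⟨hz, c, hc, d, hd, hzcd⟩
  have hyz : y - z ∈ U (n + 1) := by
    have := hUadd _ _ (hUadd _ _ ha _ hb) _ (hUneg _ _ (hUadd _ _ hc _ hd))
    rw [hyab, hzcd]
    convert this using 1
    abel
  obtain ⟨v, ⟨hvV, hvU⟩, hfv⟩ := hfO₂ (y - z) (by
    have := hO₃O₂ _ hy _ hz
    rwa [sub_sub_sub_cancel_right, ← map_sub] at this)
  obtain ⟨h, hh⟩ := hker (y - z - v) (by rw [map_sub, hfv, sub_self])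
  have hhB : h ∈ B n := hAB n (hUA n (by
    rw [hh, sub_eq_add_neg]
    exact hUadd n _ hyz _ (hUneg _ _ hvU)))
  obtain ⟨k, hk, hkh⟩ := mem_iUnion₂.1 (hn hhB)
  refine ⟨ι k, mem_image_of_mem _ hk, ?_⟩
  have hk' : ι (h - k) ∈ V₁ := interior_subset (s := ι ⁻¹' V₁) hkh
  have := hV₁V _ hvV _ hk'
  rw [map_sub, hh] at this
  convert this using 1
  abel

/-- Every Hausdorff topological abelian group embeds into one in which its Cauchy filters
converge. -/
theorem exists_completion (X : Type u) [AddCommGroup X] [TopologicalSpace X]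
    [IsTopologicalAddGroup X] [T2Space X] :
    ∃ (Z : Type u) (_ : AddCommGroup Z) (_ : TopologicalSpace Z) (_ : IsTopologicalAddGroup Z)
      (_ : T2Space Z) (j : X →+ Z), IsEmbedding j ∧
      ∀ F : Filter X, F.NeBot → Tendsto (fun p : X × X => p.1 - p.2) (F ×ˢ F) (𝓝 0) →
        ∃ z, Tendsto j F (𝓝 z) := by
  let _ := IsTopologicalAddGroup.rightUniformSpace X
  have := isUniformAddGroup_of_addCommGroup (G := X)
  refine ⟨UniformSpace.Completion X, inferInstance, inferInstance, inferInstance, inferInstance,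
    UniformSpace.Completion.toCompl,
    (UniformSpace.Completion.isUniformEmbedding_coe X).isEmbedding,
    fun F hF h => ?_⟩
  have hc : Cauchy F := (IsUniformAddGroup.cauchy_iff_tendsto F).2 ⟨hF, h⟩
  exact CompleteSpace.complete (hc.map (UniformSpace.Completion.uniformContinuous_coe X))

end Lift

/-! ### The closure of the graph in `Z × G` -/

section Graph

variable {X Z G H : Type*} [AddCommGroup X] [AddCommGroup H]
  [AddCommGroup Z] [TopologicalSpace Z] [IsTopologicalAddGroup Z]
  [AddCommGroup G] [TopologicalSpace G] [IsTopologicalAddGroup G]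

/-- The closure of the graph of `f : X → G` in `Z × G`, with `X` mapped to `Z` by `j`. -/
def closedGraph (j : X →+ Z) (f : X →+ G) : AddSubgroup (Z × G) :=
  (j.prod f).range.topologicalClosure

theorem mk_mem_closedGraph (j : X →+ Z) (f : X →+ G) (x : X) : (j x, f x) ∈ closedGraph j f :=
  AddSubgroup.le_topologicalClosure _ ⟨x, rfl⟩

theorem exists_of_mem_closedGraph {j : X →+ Z} {f : X →+ G} {p : Z × G}
    (hp : p ∈ closedGraph j f) {A : Set Z} (hA : A ∈ 𝓝 p.1) {B : Set G} (hB : B ∈ 𝓝 p.2) :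
    ∃ x, j x ∈ A ∧ f x ∈ B := by
  obtain ⟨_, hx, x, rfl⟩ := mem_closure_iff_nhds.1
    (show p ∈ closure ((j.prod f).range : Set (Z × G)) from hp) _ (prod_mem_nhds hA hB)
  exact ⟨x, hx⟩

theorem mem_closedGraph_of_tendsto {j : X →+ Z} {f : X →+ G} {F : Filter X} [F.NeBot] {z : Z}
    {g : G} (hz : Tendsto j F (𝓝 z)) (hg : Tendsto f F (𝓝 g)) : (z, g) ∈ closedGraph j f :=
  mem_closure_of_tendsto (hz.prodMk_nhds hg) (Eventually.of_forall fun x => ⟨x, rfl⟩)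

variable [TopologicalSpace X]

/-- Approximate `p` by `(j x, f x)` and replace `x` by `x - v`, where `v` is small and `f v = f x`.
This single estimate yields both the kernel and the openness of the projection of the closed graph
to `G`. -/
theorem AddMonoidHom.IsOpenOntoRange.exists_sub_mem {j : X →+ Z} {f : X →+ G}
    (hf : f.IsOpenOntoRange) (hj : Continuous j) (ι : H →+ X)
    (hker : ∀ x, f x = 0 → x ∈ Set.range ι) {V : Set Z} (hV : V ∈ 𝓝 0) :
    ∃ O ∈ 𝓝 (0 : G), ∀ p ∈ closedGraph j f, p.2 ∈ O → ∃ h, p.1 - j (ι h) ∈ V := by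
  obtain ⟨V', hV', hVV⟩ := exists_nhds_zero_half hV
  obtain ⟨O, hO, hfO⟩ := hf (j ⁻¹' V')
    (hj.continuousAt.preimage_mem_nhds (by simpa using hV'))
  refine ⟨interior O, interior_mem_nhds.2 hO, fun p hp hpO => ?_⟩
  obtain ⟨x, hx, hxO⟩ := exists_of_mem_closedGraph hp (A := {z | p.1 - z ∈ V'})
    (ContinuousAt.preimage_mem_nhds (f := fun z => p.1 - z) (by fun_prop) (by simpa using hV'))
    (isOpen_interior.mem_nhds hpO)
  obtain ⟨v, hv, hfv⟩ := hfO x (interior_subset hxO)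
  obtain ⟨h, hh⟩ := hker (x - v) (by rw [map_sub, hfv, sub_self])
  refine ⟨h, ?_⟩
  have := hVV _ hx _ hv
  rw [hh, map_sub]
  convert this using 1
  abel

/-- Closing the graph does not enlarge the kernel: the new kernel is in the closure of `H`, and `H`
is closed in `Z`. -/
theorem AddMonoidHom.IsOpenOntoRange.mem_range_of_mem_closedGraph [T2Space Z]
    [TopologicalSpace H] [CechCompleteSpace H] {j : X →+ Z} {f : X →+ G} (hf : f.IsOpenOntoRange) (hj : IsEmbedding j)
    (ι : H →+ X) (hι : IsEmbedding ι) (hker : ∀ x, f x = 0 → x ∈ Set.range ι) {z : Z}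
    (hz : (z, 0) ∈ closedGraph j f) : ∃ h, j (ι h) = z := by
  have hcl := CechCompleteSpace.isClosed_range (j.comp ι) (hj.comp hι)
  refine hcl.closure_subset (mem_closure_iff_nhds.2 fun A hA => ?_)
  obtain ⟨O, hO, h⟩ := hf.exists_sub_mem hj.continuous ι hker (V := {y | z - y ∈ A})
    (ContinuousAt.preimage_mem_nhds (f := fun y => z - y) (by fun_prop) (by simpa using hA))
  obtain ⟨k, hk⟩ := h _ hz (mem_of_mem_nhds hO)
  exact ⟨j (ι k), by simpa using hk, k, rfl⟩

end Graph

/-! ### Restriction of extensions to a dense subgroup -/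

namespace TopAddExtension

variable {G : Type u} {H : Type v} [AddCommGroup G] [TopologicalSpace G]
  [AddCommGroup H] [TopologicalSpace H]

theorem isOpenOntoRange_π (E : TopAddExtension G H) : E.π.toAddMonoidHom.IsOpenOntoRange := by
  intro V hV
  refine ⟨E.π '' V, by simpa using E.isOpenQuotientMap.isOpenMap.image_mem_nhds hV, ?_⟩
  rintro x ⟨v, hv, hvx⟩
  exact ⟨v, hv, hvx⟩

/-- Openness onto the image, unlike openness, survives composition with the inclusion of a subgroup.
-/
theorem isOpenOntoRange_subtype_π {D : AddSubgroup G} (E : TopAddExtension D H) :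
    (D.subtype.comp E.π.toAddMonoidHom).IsOpenOntoRange := by
  intro V hV
  obtain ⟨O, hO, h⟩ := E.isOpenOntoRange_π V hV
  rw [nhds_subtype_eq_comap] at hO
  obtain ⟨O', hO', hOO⟩ := mem_comap.1 hO
  refine ⟨O', hO', fun x hx => ?_⟩
  obtain ⟨v, hv, hvx⟩ := h x (hOO hx)
  exact ⟨v, hv, congrArg D.subtype hvx⟩

variable [IsTopologicalAddGroup G]

/-- Restriction of an extension of `G` to a subgroup `D`. -/
def restrict (D : AddSubgroup G) (E : TopAddExtension G H) : TopAddExtension D H :=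
  E.pullback ⟨D.subtype, continuous_subtype_val⟩

/-- The inclusion of the restriction to a subgroup. -/
def restrictIncl (D : AddSubgroup G) (E : TopAddExtension G H) : (E.restrict D).X →ₜ+ E.X where
  toFun p := p.1.1
  map_zero' := rfl
  map_add' _ _ := rfl
  continuous_toFun := continuous_fst.comp continuous_subtype_val

theorem π_restrictIncl (D : AddSubgroup G) (E : TopAddExtension G H) (p : (E.restrict D).X) :
    E.π (restrictIncl D E p) = (E.restrict D).π p := p.2

theorem restrict_congr (D : AddSubgroup G) {E F : TopAddExtension G H} (h : Equivalent E F) :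
    Equivalent (E.restrict D) (F.restrict D) := by
  obtain ⟨T, hι, hπ⟩ := h
  refine ⟨⟨⟨⟨fun p => ⟨(T p.1.1, p.1.2), (hπ _).trans p.2⟩, ?_⟩, ?_⟩, ?_⟩, fun h => ?_,
    fun p => rfl⟩
  · exact Subtype.ext (Prod.ext (map_zero T) rfl)
  · exact fun a b => Subtype.ext (Prod.ext (map_add T _ _) rfl)
  · exact ((T.continuous_toFun.comp (continuous_fst.comp continuous_subtype_val)).prodMk
      (continuous_snd.comp continuous_subtype_val)).subtype_mk _
  · exact Subtype.ext (Prod.ext (hι h) rfl)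

/-- A Cauchy filter on the middle group of an extension by a Čech-complete group converges if its
image converges. -/
theorem exists_tendsto [T2Space G] [T2Space H] [CechCompleteSpace H] (E : TopAddExtension G H)
    {F : Filter E.X} [F.NeBot]
    (hF : Tendsto (fun p : E.X × E.X => p.1 - p.2) (F ×ˢ F) (𝓝 0)) {g : G}
    (hg : Tendsto E.π F (𝓝 g)) : ∃ x, Tendsto id F (𝓝 x) := by
  have := E.t2Space
  obtain ⟨Z, _, _, _, _, j, hj, hcomplete⟩ := exists_completion E.X
  obtain ⟨z, hz⟩ := hcomplete F inferInstance hF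
  obtain ⟨y, hy⟩ := E.isOpenQuotientMap.surjective g
  have h1 : (z, g) ∈ closedGraph j E.π.toAddMonoidHom := mem_closedGraph_of_tendsto hz hg
  -- Translating by a point `y` over `g` moves the limit into the kernel of the closed graph, which
  -- is `H`.
  have h2 : (z - j y, 0) ∈ closedGraph j E.π.toAddMonoidHom := by
    have := sub_mem h1 (mk_mem_closedGraph j E.π.toAddMonoidHom y)
    rwa [Prod.mk_sub_mk, show E.π.toAddMonoidHom y = g from hy, sub_self] at this
  obtain ⟨h, hh⟩ := E.isOpenOntoRange_π.mem_range_of_mem_closedGraph hj E.ι.toAddMonoidHom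
    E.isEmbedding (fun x hx => (E.exact x).1 hx) h2
  refine ⟨E.ι h + y, hj.tendsto_nhds_iff.2 ?_⟩
  rwa [show j (E.ι h + y) = z by rw [map_add]; exact (congrArg (· + j y) hh).trans (by abel)]

/-- Extensions of `G` by a Čech-complete group are equivalent if their restrictions to a dense
subgroup are. -/
theorem equivalent_of_restrict [T2Space G] [T2Space H] [CechCompleteSpace H]
    {D : AddSubgroup G} (hD : Dense (D : Set G)) {E F : TopAddExtension G H}
    (h : Equivalent (E.restrict D) (F.restrict D)) : Equivalent E F := by
  obtain ⟨T, hTι, hTπ⟩ := h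
  have := F.t2Space
  let i : (E.restrict D).X →+ E.X := (restrictIncl D E).toAddMonoidHom
  let t : (E.restrict D).X →+ F.X :=
    { toFun := fun p => (T p).1.1
      map_zero' := by rw [map_zero]; rfl
      map_add' := fun a b => by rw [map_add]; rfl }
  have htc : Continuous t :=
    continuous_fst.comp (continuous_subtype_val.comp T.continuous_toFun)
  have hic : Continuous i := (restrictIncl D E).continuous_toFun
  have hπi : ∀ p, E.π (i p) = ((E.restrict D).π p : G) := fun p => p.2
  have hπt : ∀ p, F.π (t p) = E.π (i p) := fun p => by
    rw [hπi, ← hTπ]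
    exact (T p).2
  have hi : IsDenseInducing i := by
    refine ⟨IsInducing.of_comp hic (continuous_id.prodMk E.π.continuous_toFun) ?_, ?_⟩
    · have h := ((IsInducing.id (X := E.X)).prodMap (IsInducing.subtypeVal (t := (D : Set G)))).comp
        (IsInducing.subtypeVal (t := ((E.pullbackGroup
          (⟨D.subtype, continuous_subtype_val⟩ : D →ₜ+ G) : AddSubgroup _) : Set (E.X × D))))
      have he : (fun x => (id x, E.π x)) ∘ i = Prod.map id Subtype.val ∘ Subtype.val :=
        funext fun p => Prod.ext rfl (hπi p)
      exact he ▸ h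
    · have : range i = E.π ⁻¹' D := by
        ext x
        constructor
        · rintro ⟨p, rfl⟩
          change E.π (i p) ∈ D
          rw [hπi]
          exact ((E.restrict D).π p).2
        · intro hx
          exact ⟨⟨(x, ⟨E.π x, hx⟩), rfl⟩, rfl⟩
      rw [DenseRange, this]
      exact hD.preimage E.isOpenQuotientMap.isOpenMap
  -- The trace of `𝓝 x` on the restriction is Cauchy, so its image under `t` is too. The projection
  -- of this image converges to `E.π x`, which forces convergence in `F.X`.
  have hlim : ∀ x, ∃ y, Tendsto t (comap i (𝓝 x)) (𝓝 y) := by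
    intro x
    have := hi.comap_nhds_neBot x
    have hπ : Tendsto (fun p => F.π (t p)) (comap i (𝓝 x)) (𝓝 (E.π x)) := by
      simp only [hπt]
      exact (E.π.continuous_toFun.tendsto x).comp tendsto_comap
    have hc : Tendsto (fun p : (E.restrict D).X × (E.restrict D).X => i (p.1 - p.2))
        (comap i (𝓝 x) ×ˢ comap i (𝓝 x)) (𝓝 (i 0)) := by
      have h := (tendsto_comap (f := i) (x := 𝓝 x)).prodMap (tendsto_comap (f := i) (x := 𝓝 x))
      rw [← nhds_prod_eq] at h
      have h' := (continuous_sub.tendsto (x, x)).comp h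
      simpa [Function.comp_def] using h'
    have hc' := (htc.tendsto 0).comp (hi.isInducing.tendsto_nhds_iff.2 hc)
    rw [map_zero] at hc'
    obtain ⟨y, hy⟩ := F.exists_tendsto (F := map t (comap i (𝓝 x))) (by
      rw [prod_map_map_eq, tendsto_map'_iff]
      simpa [Function.comp_def] using hc') (tendsto_map'_iff.2 hπ)
    exact ⟨y, tendsto_map'_iff.1 hy⟩
  have hext : Continuous (hi.extend t) := hi.continuous_extend hlim
  have hexti : ∀ p, hi.extend t (i p) = t p := hi.extend_eq htc
  refine ⟨⟨⟨⟨hi.extend t, ?_⟩, ?_⟩, hext⟩, fun h => ?_, fun x => ?_⟩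
  · rw [← map_zero i, hexti, map_zero]
  · intro a b
    refine hi.dense.induction_on₂ (p := fun a b => hi.extend t (a + b) = hi.extend t a +
      hi.extend t b) (isClosed_eq (by fun_prop) (by fun_prop)) (fun a b => ?_) a b
    rw [← map_add, hexti, hexti, hexti, map_add]
  · have h1 := hexti ((E.restrict D).ι h)
    exact h1.trans (congrArg (fun p : (F.restrict D).X => p.1.1) (hTι h))
  · change F.π (hi.extend t x) = E.π x
    refine hi.dense.induction_on (p := fun x => F.π (hi.extend t x) = E.π x) x
      (isClosed_eq (F.π.continuous_toFun.comp hext) E.π.continuous_toFun) fun p => ?_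
    rw [hexti, hπt]

variable [IsTopologicalAddGroup H]

/-- Every extension of a dense subgroup `D` of `G` by a Čech-complete group is the restriction of
an extension of `G`. -/
theorem exists_equivalent_restrict [T2Space G] [T2Space H] [CechCompleteSpace H]
    {D : AddSubgroup G} (hD : Dense (D : Set G)) (E : TopAddExtension D H) :
    ∃ F : TopAddExtension G H, Equivalent E (F.restrict D) := by
  have := E.t2Space
  obtain ⟨Z, _, _, _, _, j, hj, hcomplete⟩ := exists_completion E.X
  let f : E.X →+ G := D.subtype.comp E.π.toAddMonoidHom
  have hf : f.IsOpenOntoRange := E.isOpenOntoRange_subtype_π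
  have hfc : Continuous f := continuous_subtype_val.comp E.π.continuous_toFun
  let ι : H →+ E.X := E.ι.toAddMonoidHom
  have hfι : ∀ h, f (ι h) = 0 := fun h => congrArg D.subtype (E.π_ι h)
  have hker : ∀ x, f x = 0 → x ∈ range ι := fun x hx => (E.exact x).1 (Subtype.ext hx)
  have hrange : range f = D := by
    rw [show (f : E.X → G) = Subtype.val ∘ E.π from rfl, range_comp,
      E.isOpenQuotientMap.surjective.range_eq]
    simp
  let Y := closedGraph j f
  have hιY : ∀ h, (j (ι h), (0 : G)) ∈ Y := fun h => hfι h ▸ mk_mem_closedGraph j f (ι h)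
  let F : TopAddExtension G H :=
    { X := Y
      ι :=
        { toFun := fun h => ⟨(j (ι h), 0), hιY h⟩
          map_zero' := by ext <;> simp
          map_add' := fun a b => by ext <;> simp
          continuous_toFun := ((hj.continuous.comp E.ι.continuous_toFun).prodMk
            continuous_const).subtype_mk _ }
      π :=
        { toFun := fun p => p.1.2
          map_zero' := rfl
          map_add' := fun _ _ => rfl
          continuous_toFun := continuous_snd.comp continuous_subtype_val }
      isEmbedding := IsEmbedding.of_comp (((hj.continuous.comp E.ι.continuous_toFun).prodMk
        continuous_const).subtype_mk _) (continuous_fst.comp continuous_subtype_val)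
        (hj.comp E.isEmbedding)
      isOpenQuotientMap := by
        -- The Cauchy ultrafilter over `g` has a limit `z` in the completion, and `(z, g)` is in the
        -- closed graph.
        have hsurj : ∀ g, ∃ p : Y, p.1.2 = g := fun g => by
          obtain ⟨U, hU, hUg⟩ := hf.exists_ultrafilter ι E.isEmbedding hker (g := g)
            (hrange ▸ hD g)
          obtain ⟨z, hz⟩ := hcomplete U inferInstance hU
          exact ⟨⟨(z, g), mem_closedGraph_of_tendsto hz hUg⟩, rfl⟩
        let q : Y →+ G := (AddMonoidHom.snd Z G).comp Y.subtype
        refine ⟨hsurj, continuous_snd.comp continuous_subtype_val, ?_⟩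
        change IsOpenMap q
        refine (IsTopologicalAddGroup.isOpenMap_iff_nhds_zero (f := q)).2 ?_
        intro S hS
        rw [Filter.mem_map, nhds_subtype_eq_comap, mem_comap] at hS
        obtain ⟨T, hT, hTS⟩ := hS
        rw [AddSubgroup.coe_zero, nhds_prod_eq] at hT
        obtain ⟨A, hA, B, hB, hAB⟩ := mem_prod_iff.1 hT
        obtain ⟨O, hO, h⟩ := hf.exists_sub_mem hj.continuous ι hker hA
        filter_upwards [hO, hB] with g hgO hgB
        obtain ⟨p, rfl⟩ := hsurj g
        -- An arbitrary lift of `g` is corrected by an element of `H`, which brings its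
        -- `Z`-coordinate into `A` and leaves `g` unchanged.
        obtain ⟨k, hk⟩ := h p p.2 hgO
        have := hTS (a := p - ⟨_, hιY k⟩) (hAB ⟨hk, by simpa using hgB⟩)
        have h2 : q (p - ⟨_, hιY k⟩) = p.1.2 := by simp [q]
        rw [← h2]
        exact this
      exact := by
        rintro ⟨⟨z, g⟩, hp⟩
        constructor
        · intro hg
          change g = 0 at hg
          subst hg
          obtain ⟨h, rfl⟩ := hf.mem_range_of_mem_closedGraph hj ι E.isEmbedding hker hp
          exact ⟨h, rfl⟩
        · rintro ⟨h, hh⟩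
          exact (congrArg (fun p : Y => p.1.2) hh).symm }
  refine ⟨F, ⟨⟨⟨fun x => ⟨(⟨(j x, f x), mk_mem_closedGraph j f x⟩, E.π x), rfl⟩, ?_⟩, ?_⟩, ?_⟩,
    fun h => ?_, fun x => rfl⟩
  · exact Subtype.ext (Prod.ext (Subtype.ext (Prod.ext (map_zero j) (map_zero f))) (map_zero E.π))
  · exact fun a b => Subtype.ext (Prod.ext
      (Subtype.ext (Prod.ext (map_add j a b) (map_add f a b))) (map_add E.π a b))
  · exact (((hj.continuous.prodMk hfc).subtype_mk _).prodMk
      E.π.continuous_toFun).subtype_mk _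
  · exact Subtype.ext (Prod.ext (Subtype.ext (Prod.ext rfl (hfι h))) (E.π_ι h))

/-- Both inclusions into the unrestricted middle groups agree over `G` on the pull-back, so they
induce a map to the Baer sum. Equivalence then follows from the universal property of the push-out.
-/
theorem restrict_baerSum (D : AddSubgroup G) (E F : TopAddExtension G H) :
    Equivalent ((E.restrict D).baerSum (F.restrict D)) ((E.baerSum F).restrict D) := by
  let P := (E.restrict D).diagProd (F.restrict D)
  let f₁ : P.X →ₜ+ E.X := (restrictIncl D E).comp (diagFst _ _)
  let f₂ : P.X →ₜ+ F.X := (restrictIncl D F).comp (diagSnd _ _)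
  have h₁ : ∀ p, E.π (f₁ p) = P.π p := fun p =>
    (π_restrictIncl D E _).trans (congrArg Subtype.val (π_diagFst (E.restrict D) (F.restrict D) p))
  have h₂ : ∀ p, F.π (f₂ p) = P.π p := fun p =>
    (π_restrictIncl D F _).trans (congrArg Subtype.val (π_diagSnd (E.restrict D) (F.restrict D) p))
  let l := liftBaerSum E F f₁ f₂ fun p => (h₂ p).trans (h₁ p).symm
  refine baerSum_equivalent _ _ _ ⟨⟨⟨fun p => ⟨(l p, P.π p), h₁ p⟩, ?_⟩, ?_⟩, ?_⟩ (fun h => ?_)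
    fun p => rfl
  · exact Subtype.ext (Prod.ext (map_zero l) (map_zero P.π))
  · exact fun a b => Subtype.ext (Prod.ext (map_add l a b) (map_add P.π a b))
  · exact (l.continuous_toFun.prodMk P.π.continuous_toFun).subtype_mk _
  · exact Subtype.ext (Prod.ext (liftBaerSum_ι E F f₁ f₂ _ _ h.1 h.2 rfl rfl) (P.π_ι h))

end TopAddExtension

theorem theorem3p3 {G : Type u} {H : Type v}
    [AddCommGroup G] [TopologicalSpace G] [IsTopologicalAddGroup G] [T2Space G]
    [AddCommGroup H] [TopologicalSpace H] [IsTopologicalAddGroup H] [T2Space H]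
    [CechCompleteSpace H] (D : AddSubgroup G) (hD : Dense (D : Set G)) :
    Nonempty (TopExt G H ≃+ TopExt D H) := by
  let R : TopExt G H →+ TopExt D H := AddMonoidHom.mk'
    (Quotient.map (TopAddExtension.restrict D) fun _ _ h => TopAddExtension.restrict_congr D h) (by
      rintro ⟨E⟩ ⟨F⟩
      exact Quotient.sound (TopAddExtension.restrict_baerSum D E F).symm)
  refine ⟨AddEquiv.ofBijective R ⟨?_, ?_⟩⟩
  · rintro ⟨E⟩ ⟨F⟩ h
    exact Quotient.sound (TopAddExtension.equivalent_of_restrict hD (Quotient.exact h))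
  · rintro ⟨E⟩
    obtain ⟨F, hF⟩ := TopAddExtension.exists_equivalent_restrict hD E
    exact ⟨Quotient.mk _ F, Quotient.sound hF.symm⟩
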